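/- \textbf{Setting.} All manifolds are real, smooth, finite-dimensional and without boundary. Let $H$ be a Lie group with Lie algebra $\mathfrak h=T_eH$, and let $\mu$ be a multiplicative $4$-vector field on $H$, i.e. a smooth $4$-vector field with $\mu(gh)=(l_g)_*\mu(h)+(r_h)_*\mu(g)$ for all $g,h\in H$, where $l_g$ and $r_h$ are left and right translation (so $\mu(e)=0$). Let $(P,\xi)$ be a quatrisson manifold, i.e. $\xi$ is a smooth $4$-vector field on the manifold $P$ whose Schouten bracket with itself vanishes, $[\xi,\xi]=0$. Let $H$ act smoothly on $P$ from the left and multiplicatively, i.e. \[ \xi(h\cdot x)=(\beta_h)_*\,\xi(x)+(\beta_x)_*\,\mu(h)\qquad(h\in H,\ x\in P),\] where $\beta_h:P\to P$, $y\mapsto h\cdot y$, and $\beta_x:H\to P$, $h\mapsto h\cdot x$. Let $\gamma:\mathfrak h\to\chi(P)$, $\gamma(X)(x)=\frac{d}{dt}\big|_{t=0}\exp(tX)\cdot x$, be the infinitesimal action. Let $d_e\mu:\mathfrak h\to\wedge^4\mathfrak h$ be the intrinsic derivative of $\mu$ at $e$, i.e. the linearization of $\mu$ at its zero $e$; equivalently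 $d_e\mu(X)=(\mathcal L_{\bar X}\mu)(e)$ for any smooth vector field $\bar X$ on $H$ with $\bar X(e)=X$. Let $[\cdot,\cdot,\cdot,\cdot]$ be the $4$-bracket on $\mathfrak h^*$ dual to $d_e\mu$, i.e. $\langle[\zeta_1,\zeta_2,\zeta_3,\zeta_4],X\rangle=\langle\zeta_1\wedge\zeta_2\wedge\zeta_3\wedge\zeta_4,\ d_e\mu(X)\rangle$. \textbf{Theorem.} For every $X\in\mathfrak h$, \[ \mathcal L_{\gamma(X)}\xi=\wedge^4\gamma\,(d_e\mu(X)),\] where the right-hand side is the $4$-vector field whose value at $x\in P$ is the image of $d_e\mu(X)$ under $\wedge^4$ of the linear map $\mathfrak h\to T_xP$, $Y\mapsto\gamma(Y)(x)$. Moreover, for every $X\in\mathfrak h$ and all $1$-forms $\omega_1,\dots,\omega_4$ on $P$, \[ (\mathcal L_{\gamma(X)}\xi)(\omega_1\wedge\omega_2\wedge\omega_3\wedge\omega_4)=\langle[\zeta_1,\zeta_2,\zeta_3,\zeta_4],X\rangle,\] where $\zeta_i$ is the $\mathfrak h^*$-valued function on $P$ defined by $\langle\zeta_i,Y\rangle=\langle\omega_i,\gamma(Y)\rangle$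 for $Y\in\mathfrak h$, and the $4$-bracket is taken pointwise. -/

import Mathlib

set_option maxSynthPendingDepth 3

open scoped Manifold ContDiff

noncomputable section

/-! ### Multivectors on a vector space -/

/-- The space `⋀ᵏ V` of `k`-vectors of a finite-dimensional real vector space `V`, realised as
alternating `k`-linear forms on the dual `V*`. The value of `w` on `(α₁, …, α_k)` is the pairing
`⟨w, α₁ ∧ … ∧ α_k⟩`, so that `v₁ ∧ … ∧ v_k` is the form `α ↦ det (α_i (v_j))`. -/
abbrev MultiVector (k : ℕ) (V : Type*) [AddCommGroup V] [Module ℝ V] [TopologicalSpace V] :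
    Type _ :=
  (V →L[ℝ] ℝ) [⋀^Fin k]→L[ℝ] ℝ

namespace MultiVector

variable {V W : Type*}
  [AddCommGroup V] [Module ℝ V] [TopologicalSpace V]
  [AddCommGroup W] [Module ℝ W] [TopologicalSpace W]

/-- The map `⋀ᵏ A : ⋀ᵏ V → ⋀ᵏ W` induced by a linear map `A : V → W`. -/
def map (k : ℕ) (A : V →L[ℝ] W) : MultiVector k V →L[ℝ] MultiVector k W :=
  ContinuousAlternatingMap.compContinuousLinearMapCLM (ContinuousLinearMap.precomp ℝ A)

theorem map_apply (k : ℕ) (A : V →L[ℝ] W) (w : MultiVector k V) (α : Fin k → (W →L[ℝ] ℝ)) :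
    map k A w α = w (fun i => (α i).comp A) := rfl

end MultiVector

/-! ### Lie derivative and Schouten bracket on a vector space -/

section Local

variable {E : Type*} [NormedAddCommGroup E] [NormedSpace ℝ E]

/-- The Lie derivative at `y` of the `k`-vector field `Ξ` on a vector space along the vector
field `V`. -/
def localLieDeriv {k : ℕ} (V : E → E) (Ξ : E → MultiVector k E) (y : E) : MultiVector k E :=
  fderiv ℝ Ξ y (V y) -
    (Ξ y).fderivCompContinuousLinearMap (ContinuousLinearMap.id ℝ (E →L[ℝ] ℝ))
      (ContinuousLinearMap.precomp ℝ (fderiv ℝ V y))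

/-- In coordinates: `(L_V Ξ)^{i₁…i_k} = V^j ∂_j Ξ^{i₁…i_k} - ∑_l Ξ^{i₁…j…i_k} ∂_j V^{i_l}`. -/
theorem localLieDeriv_apply {k : ℕ} (V : E → E) (Ξ : E → MultiVector k E) (y : E)
    (α : Fin k → (E →L[ℝ] ℝ)) :
    localLieDeriv V Ξ y α = fderiv ℝ Ξ y (V y) α -
      ∑ l, Ξ y (Function.update α l ((α l).comp (fderiv ℝ V y))) := by
  rw [localLieDeriv, ContinuousAlternatingMap.sub_apply,
    ContinuousAlternatingMap.fderivCompContinuousLinearMap_apply]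
  congr 1
  refine Finset.sum_congr rfl fun l _ => congrArg _ (funext fun j => ?_)
  by_cases h : j = l
  · subst h; simp
  · simp [h]

/-- The value at `y` of `∑ⱼ (ι_{dxʲ} P) ∧ ∂ⱼ Q`, for an `(m+1)`-vector field `P` and an
`(n+1)`-vector field `Q` on a vector space with coordinates `xʲ`; here `ι_α P = P (α, ·)`. -/
def localSchoutenHalf {m n N : ℕ} (h : m + (n + 1) = N) (P : E → MultiVector (m + 1) E)
    (Q : E → MultiVector (n + 1) E) (y : E) : MultiVector N E :=
  ((m.factorial : ℝ) * ((n + 1).factorial : ℝ))⁻¹ •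
    ContinuousMultilinearMap.alternatization
      (((((ContinuousAlternatingMap.toContinuousMultilinearMapCLM ℝ).comp
          (P y).curryLeft).compContinuousMultilinearMap
          (fderiv ℝ Q y).flipAlternating.toContinuousMultilinearMap).uncurrySum).domDomCongr
        (((Equiv.sumComm (Fin (n + 1)) (Fin m)).trans finSumFinEquiv).trans (finCongr h)))

theorem localSchoutenHalf_apply {m n N : ℕ} (h : m + (n + 1) = N) (P : E → MultiVector (m + 1) E)
    (Q : E → MultiVector (n + 1) E) (y : E) (α : Fin N → (E →L[ℝ] ℝ)) :
    localSchoutenHalf h P Q y α =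
      ((m.factorial : ℝ) * ((n + 1).factorial : ℝ))⁻¹ *
        ∑ σ : Equiv.Perm (Fin N), ((Equiv.Perm.sign σ : ℤ) : ℝ) *
          P y (Matrix.vecCons
            ((fderiv ℝ Q y).flipAlternating fun j => α (σ (Fin.cast h (Fin.natAdd m j))))
            fun i => α (σ (Fin.cast h (Fin.castAdd (n + 1) i)))) := by
  simp only [localSchoutenHalf, ContinuousAlternatingMap.smul_apply, smul_eq_mul,
    ContinuousMultilinearMap.alternatization_apply_apply]
  congr 1
  refine Finset.sum_congr rfl fun σ _ => ?_
  rw [Units.smul_def, zsmul_eq_mul]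
  congr 1

/-- The Schouten bracket of an `(m+1)`-vector field `P` and an `(n+1)`-vector field `Q` on a
vector space, with the sign convention `[P, Q] = (-1)^{pq} [Q, P]`, `p = m + 1`, `q = n + 1`,
which gives the Lie bracket for `p = q = 1`. -/
def localSchouten {m n : ℕ} (P : E → MultiVector (m + 1) E) (Q : E → MultiVector (n + 1) E)
    (y : E) : MultiVector (m + n + 1) E :=
  localSchoutenHalf (by omega) P Q y +
    (-1 : ℝ) ^ ((m + 1) * (n + 1)) • localSchoutenHalf (by omega) Q P y

end Local

/-! ### Multivector fields on manifolds -/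

section Manifold

variable {E : Type*} [NormedAddCommGroup E] [NormedSpace ℝ E]
  {H : Type*} [TopologicalSpace H] (I : ModelWithCorners ℝ E H)
  (M : Type*) [TopologicalSpace M] [ChartedSpace H M]

/-- A (not necessarily smooth) `k`-vector field on a manifold. -/
abbrev MultiVectorField (k : ℕ) : Type _ :=
  (x : M) → MultiVector k (TangentSpace I x)

variable {M}

/-- The derivative `T_z M → E` at `z` of the preferred chart at `x₀`. -/
def chartDeriv (x₀ z : M) : TangentSpace I z →L[ℝ] E :=
  (mfderiv I 𝓘(ℝ, E) (extChartAt I x₀) z :)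

/-- The inverse `E → T_x M` of the derivative at `x` of the preferred chart at `x`. -/
def chartDerivInv (x : M) : E →L[ℝ] TangentSpace I x :=
  (chartDeriv I x x).inverse

variable {I}

/-- The `k`-vector field `ξ` read in the preferred chart at `x₀`. -/
def MultiVectorField.inChart {k : ℕ} (ξ : MultiVectorField I M k) (x₀ : M) (y : E) :
    MultiVector k E :=
  MultiVector.map k (chartDeriv I x₀ ((extChartAt I x₀).symm y))
    (ξ ((extChartAt I x₀).symm y))

/-- The vector field `V` read in the preferred chart at `x₀`. -/
def vectorFieldInChart (V : (x : M) → TangentSpace I x) (x₀ : M) (y : E) : E :=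
  chartDeriv I x₀ ((extChartAt I x₀).symm y) (V ((extChartAt I x₀).symm y))

/-- A `k`-vector field is smooth if its components in charts are smooth. -/
def MultiVectorField.IsSmooth {k : ℕ} (ξ : MultiVectorField I M k) : Prop :=
  ∀ x₀ : M, ContDiffOn ℝ ∞ (ξ.inChart x₀) (extChartAt I x₀).target

/-- The Lie derivative `L_V ξ` of a `k`-vector field `ξ` along a vector field `V`. -/
def MultiVectorField.lieDeriv {k : ℕ} (V : (x : M) → TangentSpace I x)
    (ξ : MultiVectorField I M k) : MultiVectorField I M k := fun x =>
  MultiVector.map k (chartDerivInv I x)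
    (localLieDeriv (vectorFieldInChart V x) (ξ.inChart x) (extChartAt I x x))

/-- The Schouten bracket of an `(m+1)`-vector field and an `(n+1)`-vector field. -/
def MultiVectorField.schouten {m n : ℕ} (P : MultiVectorField I M (m + 1))
    (Q : MultiVectorField I M (n + 1)) : MultiVectorField I M (m + n + 1) := fun x =>
  MultiVector.map (m + n + 1) (chartDerivInv I x)
    (localSchouten (P.inChart x) (Q.inChart x) (extChartAt I x x))

/-- A quatrisson structure: a smooth 4-vector field `ξ` with `[ξ, ξ] = 0`. -/
structure IsQuatrisson (ξ : MultiVectorField I M 4) : Prop where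
  smooth : ξ.IsSmooth
  schouten_self : MultiVectorField.schouten (m := 3) (n := 3) ξ ξ = 0

/-- The intrinsic derivative `d_x ξ : T_x M → ⋀ᵏ T_x M` of a `k`-vector field `ξ` vanishing at `x`:
the derivative at `x` of the components of `ξ`. It is given by `d_x ξ (V x) = (L_V ξ) x` for every
vector field `V`, see `MultiVectorField.lieDeriv_eq_intrinsicDeriv`. -/
def MultiVectorField.intrinsicDeriv {k : ℕ} (ξ : MultiVectorField I M k) (x : M) :
    TangentSpace I x →L[ℝ] MultiVector k (TangentSpace I x) :=
  ((MultiVector.map k (chartDerivInv I x)).comp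
    (fderiv ℝ (ξ.inChart x) (extChartAt I x x))).comp (chartDeriv I x x)

theorem MultiVectorField.lieDeriv_eq_intrinsicDeriv {k : ℕ} (ξ : MultiVectorField I M k) (x : M)
    (hx : ξ x = 0) (V : (x : M) → TangentSpace I x) :
    ξ.lieDeriv V x = ξ.intrinsicDeriv x (V x) := by
  have hz : (extChartAt I x).symm (extChartAt I x x) = x := extChartAt_to_inv x
  have h0 : ξ.inChart x (extChartAt I x x) = 0 := by
    rw [MultiVectorField.inChart, hz, hx, map_zero]
  have hV : vectorFieldInChart V x (extChartAt I x x) = chartDeriv I x x (V x) := by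
    rw [vectorFieldInChart, hz]
  have h1 : localLieDeriv (vectorFieldInChart V x) (ξ.inChart x) (extChartAt I x x) =
      fderiv ℝ (ξ.inChart x) (extChartAt I x x) (chartDeriv I x x (V x)) := by
    ext α
    rw [localLieDeriv_apply, h0, hV]
    simp
  rw [MultiVectorField.lieDeriv, h1]
  rfl

end Manifold

/-! ### Multiplicative 4-vector fields and multiplicative actions -/

section Action

variable {E : Type*} [NormedAddCommGroup E] [NormedSpace ℝ E]
  {H : Type*} [TopologicalSpace H] {I : ModelWithCorners ℝ E H}
  {G : Type*} [TopologicalSpace G] [ChartedSpace H G] [Group G]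
  {E' : Type*} [NormedAddCommGroup E'] [NormedSpace ℝ E']
  {H' : Type*} [TopologicalSpace H'] {J : ModelWithCorners ℝ E' H'}
  {P : Type*} [TopologicalSpace P] [ChartedSpace H' P] [MulAction G P]

/-- A smooth 4-vector field `μ` on a Lie group is multiplicative if
`μ (g h) = (l_g)_* μ (h) + (r_h)_* μ (g)`. -/
structure IsMultiplicative (μ : MultiVectorField I G 4) : Prop where
  smooth : μ.IsSmooth
  map_mul : ∀ g h : G, μ (g * h) =
    MultiVector.map 4 (mfderiv I I (fun h' : G => g * h') h) (μ h) +
      MultiVector.map 4 (mfderiv I I (fun g' : G => g' * h) g) (μ g)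

/-- A multiplicative 4-vector field vanishes at the identity. -/
theorem IsMultiplicative.apply_one {μ : MultiVectorField I G 4} (hμ : IsMultiplicative μ) :
    μ (1 : G) = 0 := by
  have hf : ∀ f : G → G, f = id →
      (mfderiv I I f (1 : G) : E →L[ℝ] E) = ContinuousLinearMap.id ℝ E := by
    rintro f rfl
    exact mfderiv_id
  have hμ' : ∀ g : G, g = 1 → (μ g : MultiVector 4 E) = μ 1 := by
    rintro g rfl
    rfl
  have h1 : (μ (1 : G) : MultiVector 4 E) = μ 1 + μ 1 := by
    have h := hμ.map_mul 1 1
    have e1 := hf (fun h' : G => 1 * h') (by funext; simp)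
    have e2 := hf (fun g' : G => g' * 1) (by funext; simp)
    refine (hμ' _ (one_mul 1)).symm.trans (h.trans ?_)
    change MultiVector.map 4 (_ : E →L[ℝ] E) (μ 1) + MultiVector.map 4 (_ : E →L[ℝ] E) (μ 1) = _
    rw [e1, e2]
    rfl
  have h2 : ∀ w : MultiVector 4 E, w = w + w → w = 0 := by
    intro w hw
    ext α
    have h : w α = w α + w α := congrArg (fun u : MultiVector 4 E => u α) hw
    simpa using h
  exact h2 _ h1

/-- The action of `(G, μ)` on `(P, ξ)` is multiplicative:
`ξ (h • x) = (β_h)_* ξ (x) + (β_x)_* μ (h)`, where `β_h y = h • y` and `β_x h = h • x`. -/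
def IsMultiplicativeAction (μ : MultiVectorField I G 4) (ξ : MultiVectorField J P 4) : Prop :=
  ∀ (h : G) (x : P), ξ (h • x) =
    MultiVector.map 4 (mfderiv J J (fun y : P => h • y) x) (ξ x) +
      MultiVector.map 4 (mfderiv I J (fun h' : G => h' • x) h) (μ h)

variable (I J) in
/-- The infinitesimal action at `x`: the derivative `𝔥 → T_x P` at the identity of `h ↦ h • x`. -/
def infinitesimalActionAt (x : P) : GroupLieAlgebra I G →L[ℝ] TangentSpace J x :=
  (mfderiv I J (fun h : G => h • x) (1 : G) :)

variable (J P) in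
/-- The vector field `γ(X)` on `P` generated by `X ∈ 𝔥`,
`γ(X)(x) = d/dt|_{t=0} exp(tX) • x`. -/
def infinitesimalAction (X : GroupLieAlgebra I G) : (x : P) → TangentSpace J x :=
  fun x => infinitesimalActionAt I J x X

/-- The 4-bracket on `𝔥*` dual to `d_e μ : 𝔥 → ⋀⁴ 𝔥`:
`⟨[ζ₁, ζ₂, ζ₃, ζ₄], X⟩ = ⟨ζ₁ ∧ ζ₂ ∧ ζ₃ ∧ ζ₄, d_e μ (X)⟩`. -/
def fourBracket (μ : MultiVectorField I G 4) (ζ : Fin 4 → (GroupLieAlgebra I G →L[ℝ] ℝ)) :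
    GroupLieAlgebra I G →L[ℝ] ℝ :=
  (ContinuousAlternatingMap.apply ℝ (GroupLieAlgebra I G →L[ℝ] ℝ) ℝ ζ).comp
    (μ.intrinsicDeriv (1 : G))

variable (I) in
/-- The `𝔥*`-valued function `ζ` on `P` induced by a 1-form `θ`: `⟨ζ, X⟩ = ⟨θ, γ(X)⟩`. -/
def inducedFunction (θ : (x : P) → (TangentSpace J x →L[ℝ] ℝ)) (x : P) :
    GroupLieAlgebra I G →L[ℝ] ℝ :=
  (θ x).comp (infinitesimalActionAt I J x)

end Action

end

open scoped Topology

section Local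

variable {E E' : Type*} [NormedAddCommGroup E] [NormedSpace ℝ E]
  [NormedAddCommGroup E'] [NormedSpace ℝ E']

theorem MultiVector.map_comp_apply {k : ℕ} {V₁ V₂ V₃ : Type*}
    [AddCommGroup V₁] [Module ℝ V₁] [TopologicalSpace V₁]
    [AddCommGroup V₂] [Module ℝ V₂] [TopologicalSpace V₂]
    [AddCommGroup V₃] [Module ℝ V₃] [TopologicalSpace V₃]
    (B : V₂ →L[ℝ] V₃) (A : V₁ →L[ℝ] V₂) (w : MultiVector k V₁) :
    MultiVector.map k B (MultiVector.map k A w) = MultiVector.map k (B.comp A) w := rfl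

/-- The product rule for `t ↦ ⋀ᵏ (A t) (w t)`. -/
theorem HasFDerivAt.multiVectorMap {k : ℕ} {T : Type*} [NormedAddCommGroup T] [NormedSpace ℝ T]
    {w : T → MultiVector k E} {w' : T →L[ℝ] MultiVector k E}
    {A : T → E →L[ℝ] E'} {A' : T →L[ℝ] E →L[ℝ] E'} {t : T}
    (hw : HasFDerivAt w w' t) (hA : HasFDerivAt A A' t) :
    HasFDerivAt (fun s => MultiVector.map k (A s) (w s))
      ((MultiVector.map k (A t)).comp w' +
        ((w t).fderivCompContinuousLinearMap (ContinuousLinearMap.precomp ℝ (A t))).comp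
          (((ContinuousLinearMap.compL ℝ E E' ℝ).flip).comp A')) t :=
  hw.continuousAlternatingMapCompContinuousLinearMap
    (((ContinuousLinearMap.compL ℝ E E' ℝ).flip).hasFDerivAt.comp t hA)

/-- The infinitesimal form of the identity
`Ξ (a (t, y₀)) = ⋀ᵏ (∂_y a) (Ξ y₀) + ⋀ᵏ (∂_t a) (M t)` for a local action `a`. -/
theorem localLieDeriv_eq_of_localAction {k : ℕ} {a : E × E' → E'} {t₀ : E} {y₀ : E'}
    (ha : ContDiffAt ℝ 2 a (t₀, y₀)) (ha₀ : ∀ᶠ y in 𝓝 y₀, a (t₀, y) = y)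
    {Ξ : E' → MultiVector k E'} (hΞ : DifferentiableAt ℝ Ξ y₀)
    {M : E → MultiVector k E} (hM : DifferentiableAt ℝ M t₀) (hM₀ : M t₀ = 0)
    (hmul : ∀ᶠ t in 𝓝 t₀, Ξ (a (t, y₀)) =
      MultiVector.map k (fderiv ℝ (fun y => a (t, y)) y₀) (Ξ y₀) +
        MultiVector.map k (fderiv ℝ (fun s => a (s, y₀)) t) (M t))
    {V : E' → E'} {v : E}
    (hV : ∀ᶠ y in 𝓝 y₀, V y = fderiv ℝ (fun s => a (s, y)) t₀ v) :
    localLieDeriv V Ξ y₀ =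
      MultiVector.map k (fderiv ℝ (fun s => a (s, y₀)) t₀) (fderiv ℝ M t₀ v) := by
  have hd : ∀ᶠ p in 𝓝 (t₀, y₀), DifferentiableAt ℝ a p := by
    filter_upwards [ha.eventually (by simp)] with p hp
    exact hp.differentiableAt (by norm_num)
  have hcy : ContinuousAt (fun y : E' => (t₀, y)) y₀ := by fun_prop
  have hct : ContinuousAt (fun t : E => (t, y₀)) t₀ := by fun_prop
  have hpy : ∀ p : E × E', HasFDerivAt (fun y : E' => (p.1, y))
      (ContinuousLinearMap.inr ℝ E E') p.2 := fun p => hasFDerivAt_prodMk_right p.1 p.2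
  have hpt : ∀ p : E × E', HasFDerivAt (fun s : E => (s, p.2))
      (ContinuousLinearMap.inl ℝ E E') p.1 := fun p => hasFDerivAt_prodMk_left p.1 p.2
  have hdy : ∀ p : E × E', DifferentiableAt ℝ a p →
      fderiv ℝ (fun y => a (p.1, y)) p.2 =
        (fderiv ℝ a p).comp (ContinuousLinearMap.inr ℝ E E') := fun p hp =>
    (hp.hasFDerivAt.comp p.2 (hpy p)).fderiv
  have hdt : ∀ p : E × E', DifferentiableAt ℝ a p →
      fderiv ℝ (fun s => a (s, p.2)) p.1 =
        (fderiv ℝ a p).comp (ContinuousLinearMap.inl ℝ E E') := fun p hp =>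
    (hp.hasFDerivAt.comp p.1 (hpt p)).fderiv
  have h2 : DifferentiableAt ℝ (fderiv ℝ a) (t₀, y₀) :=
    (ha.fderiv_right (m := 1) (by norm_num)).differentiableAt (by norm_num)
  have hsymm : IsSymmSndFDerivAt ℝ a (t₀, y₀) := ha.isSymmSndFDerivAt (by simp)
  set D2 := fderiv ℝ (fderiv ℝ a) (t₀, y₀) with hD2
  have hA : HasFDerivAt (fun t => (fderiv ℝ a (t, y₀)).comp (ContinuousLinearMap.inr ℝ E E'))
      ((((ContinuousLinearMap.compL ℝ E' (E × E') E').flip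
        (ContinuousLinearMap.inr ℝ E E')).comp D2).comp (ContinuousLinearMap.inl ℝ E E')) t₀ :=
    ((((ContinuousLinearMap.compL ℝ E' (E × E') E').flip
        (ContinuousLinearMap.inr ℝ E E')).hasFDerivAt.comp (t₀, y₀) h2.hasFDerivAt).comp t₀
          (hpt (t₀, y₀)) :)
  have hB : HasFDerivAt (fun t => (fderiv ℝ a (t, y₀)).comp (ContinuousLinearMap.inl ℝ E E'))
      ((((ContinuousLinearMap.compL ℝ E (E × E') E').flip
        (ContinuousLinearMap.inl ℝ E E')).comp D2).comp (ContinuousLinearMap.inl ℝ E E')) t₀ :=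
    ((((ContinuousLinearMap.compL ℝ E (E × E') E').flip
        (ContinuousLinearMap.inl ℝ E E')).hasFDerivAt.comp (t₀, y₀) h2.hasFDerivAt).comp t₀
          (hpt (t₀, y₀)) :)
  have hid : (fderiv ℝ a (t₀, y₀)).comp (ContinuousLinearMap.inr ℝ E E') =
      ContinuousLinearMap.id ℝ E' := by
    rw [← hdy (t₀, y₀) hd.self_of_nhds]
    exact (Filter.EventuallyEq.fderiv_eq (f := id) ha₀).trans fderiv_id
  have hV' : HasFDerivAt V ((ContinuousLinearMap.apply ℝ E' (v, (0 : E'))).comp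
      (D2.comp (ContinuousLinearMap.inr ℝ E E'))) y₀ := by
    refine HasFDerivAt.congr_of_eventuallyEq (f := fun y => fderiv ℝ a (t₀, y) (v, 0)) ?_ ?_
    · exact (ContinuousLinearMap.apply ℝ E' (v, (0 : E'))).hasFDerivAt.comp y₀
        (h2.hasFDerivAt.comp y₀ (hpy (t₀, y₀)))
    · filter_upwards [hV, hcy.eventually hd] with y hy hy'
      rw [hy, hdt (t₀, y) hy']
      simp
  have hVy : V y₀ = fderiv ℝ a (t₀, y₀) (v, 0) := by
    rw [hV.self_of_nhds, hdt (t₀, y₀) hd.self_of_nhds]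
    simp
  have ha0 : a (t₀, y₀) = y₀ := ha₀.self_of_nhds
  have hL : HasFDerivAt (fun t => Ξ (a (t, y₀))) ((fderiv ℝ Ξ y₀).comp
      ((fderiv ℝ a (t₀, y₀)).comp (ContinuousLinearMap.inl ℝ E E'))) t₀ := by
    have h1 : HasFDerivAt (fun t => a (t, y₀))
        ((fderiv ℝ a (t₀, y₀)).comp (ContinuousLinearMap.inl ℝ E E')) t₀ :=
      hd.self_of_nhds.hasFDerivAt.comp t₀ (hpt (t₀, y₀))
    refine HasFDerivAt.comp t₀ (g := Ξ) ?_ h1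
    rw [ha0]
    exact hΞ.hasFDerivAt
  have hR := ((hasFDerivAt_const (Ξ y₀) t₀).multiVectorMap hA).add (hM.hasFDerivAt.multiVectorMap hB)
  have hEq : (fun t => Ξ (a (t, y₀))) =ᶠ[𝓝 t₀] fun t =>
      MultiVector.map k ((fderiv ℝ a (t, y₀)).comp (ContinuousLinearMap.inr ℝ E E')) (Ξ y₀) +
        MultiVector.map k ((fderiv ℝ a (t, y₀)).comp (ContinuousLinearMap.inl ℝ E E')) (M t) := by
    filter_upwards [hmul, hct.eventually hd] with t ht ht'
    rw [ht, hdy (t, y₀) ht', hdt (t, y₀) ht']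
  have key := congrArg (fun L => L v) (hL.unique (hR.congr_of_eventuallyEq hEq))
  rw [hdt (t₀, y₀) hd.self_of_nhds, localLieDeriv, hV'.fderiv, hVy, sub_eq_iff_eq_add]
  have hDV : (ContinuousLinearMap.apply ℝ E' (v, (0 : E'))).comp
      (D2.comp (ContinuousLinearMap.inr ℝ E E')) =
      (D2 (v, 0)).comp (ContinuousLinearMap.inr ℝ E E') := by
    ext w
    exact hsymm (0, w) (v, 0)
  rw [hDV]
  ext α
  have key' := congrArg (fun L => L α) key
  have hpre : ContinuousLinearMap.precomp ℝ (ContinuousLinearMap.id ℝ E') =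
      ContinuousLinearMap.id ℝ (E' →L[ℝ] ℝ) := rfl
  have hflip : ∀ A : E' →L[ℝ] E', (ContinuousLinearMap.compL ℝ E' E' ℝ).flip A =
      ContinuousLinearMap.precomp ℝ A := fun _ => rfl
  simpa [hid, hM₀, hpre, hflip, add_comm,
    ContinuousAlternatingMap.fderivCompContinuousLinearMap_apply] using key'

end Local

section Charts

variable {E : Type*} [NormedAddCommGroup E] [NormedSpace ℝ E]
  {H : Type*} [TopologicalSpace H] {I : ModelWithCorners ℝ E H}
  {M : Type*} [TopologicalSpace M] [ChartedSpace H M]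
  {E' : Type*} [NormedAddCommGroup E'] [NormedSpace ℝ E']
  {H' : Type*} [TopologicalSpace H'] {J : ModelWithCorners ℝ E' H'}
  {N : Type*} [TopologicalSpace N] [ChartedSpace H' N]

theorem MultiVectorField.inChart_extChartAt {k : ℕ} (ξ : MultiVectorField I M k) {x₀ z : M}
    (hz : z ∈ (extChartAt I x₀).source) :
    ξ.inChart x₀ (extChartAt I x₀ z) = MultiVector.map k (chartDeriv I x₀ z) (ξ z) := by
  have h : ∀ z', z' = z → MultiVector.map k (chartDeriv I x₀ z') (ξ z') =
      MultiVector.map k (chartDeriv I x₀ z) (ξ z) := by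
    rintro _ rfl
    rfl
  exact h _ ((extChartAt I x₀).left_inv hz)

theorem MultiVectorField.IsSmooth.differentiableAt_inChart [I.Boundaryless] {k : ℕ}
    {ξ : MultiVectorField I M k} (hξ : ξ.IsSmooth) (x : M) :
    DifferentiableAt ℝ (ξ.inChart x) (extChartAt I x x) :=
  ((hξ x).contDiffAt (extChartAt_target_mem_nhds x)).differentiableAt (by simp)

theorem mdifferentiableAt_extChartAt_symm [IsManifold I ∞ M] [I.Boundaryless] (x₀ : M) {y : E}
    (hy : y ∈ (extChartAt I x₀).target) :
    MDifferentiableAt 𝓘(ℝ, E) I (extChartAt I x₀).symm y :=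
  ((contMDiffOn_extChartAt_symm (n := ∞) x₀).contMDiffAt
    ((isOpen_extChartAt_target x₀).mem_nhds hy)).mdifferentiableAt (by simp)

/-- The derivative of a map read in charts, in terms of its manifold derivative. -/
theorem fderiv_inCharts_chartDeriv [IsManifold I ∞ M] [I.Boundaryless] [IsManifold J ∞ N]
    {f : M → N} {x₁ z : M} {x₂ w : N} (hf : MDifferentiableAt I J f z)
    (hz : z ∈ (extChartAt I x₁).source) (hw : f z = w) (hws : w ∈ (extChartAt J x₂).source)
    (u : TangentSpace I z) :
    fderiv ℝ (fun y => extChartAt J x₂ (f ((extChartAt I x₁).symm y))) (extChartAt I x₁ z)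
        (chartDeriv I x₁ z u) =
      chartDeriv J x₂ w (mfderiv I J f z u : E') := by
  subst hw
  have h₁ : MDifferentiableAt I 𝓘(ℝ, E) (extChartAt I x₁) z :=
    (contMDiffAt_extChartAt' (n := ∞) (by simpa using hz)).mdifferentiableAt (by simp)
  have h₂ : MDifferentiableAt J 𝓘(ℝ, E') (extChartAt J x₂) (f z) :=
    (contMDiffAt_extChartAt' (n := ∞) (by simpa using hws)).mdifferentiableAt (by simp)
  have h₃ := mdifferentiableAt_extChartAt_symm x₁ ((extChartAt I x₁).map_source hz)
  have hzz := (extChartAt I x₁).left_inv hz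
  have hF : MDifferentiableAt 𝓘(ℝ, E) 𝓘(ℝ, E')
      (fun y => extChartAt J x₂ (f ((extChartAt I x₁).symm y))) (extChartAt I x₁ z) :=
    MDifferentiableAt.comp_of_eq _ (g := fun p => extChartAt J x₂ (f p))
      (h₂.comp z hf) h₃ hzz
  have hEq : (fun p => extChartAt J x₂ (f ((extChartAt I x₁).symm (extChartAt I x₁ p))))
      =ᶠ[𝓝 z] fun p => extChartAt J x₂ (f p) := by
    filter_upwards [extChartAt_source_mem_nhds' hz] with p hp
    rw [(extChartAt I x₁).left_inv hp]
  have hL := mfderiv_comp_apply z hF h₁ u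
  have hR := mfderiv_comp_apply z h₂ hf u
  have hEq' := congrArg (fun L => L u)
    (hEq.mfderiv_eq (I := I) (I' := 𝓘(ℝ, E')))
  rw [mfderiv_eq_fderiv] at hL
  exact hL.symm.trans (hEq'.trans hR)

end Charts

section SmoothAction

variable {E : Type*} [NormedAddCommGroup E] [NormedSpace ℝ E]
  {H : Type*} [TopologicalSpace H] (I : ModelWithCorners ℝ E H)
  {G : Type*} [TopologicalSpace G] [ChartedSpace H G] [Group G]
  {E' : Type*} [NormedAddCommGroup E'] [NormedSpace ℝ E']
  {H' : Type*} [TopologicalSpace H'] (J : ModelWithCorners ℝ E' H')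
  {P : Type*} [TopologicalSpace P] [ChartedSpace H' P] [MulAction G P]

theorem mdifferentiable_smul_const [ContMDiffSMul I J ∞ G P] (x : P) : MDifferentiable I J (fun h : G => h • x) :=
  ((ContMDiffSMul.contMDiff_smul (I := I) (I' := J) (n := ∞) (G := G) (M := P)).comp
    (contMDiff_id.prodMk contMDiff_const)).mdifferentiable (by simp)

theorem mdifferentiable_const_smul [ContMDiffSMul I J ∞ G P] (h : G) :
    MDifferentiable J J (fun y : P => h • y) :=
  ((ContMDiffSMul.contMDiff_smul (I := I) (I' := J) (n := ∞) (G := G) (M := P)).comp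
    (contMDiff_const.prodMk contMDiff_id)).mdifferentiable (by simp)

end SmoothAction

section Action

variable {E : Type*} [NormedAddCommGroup E] [NormedSpace ℝ E]
  {H : Type*} [TopologicalSpace H] (I : ModelWithCorners ℝ E H) [I.Boundaryless]
  {G : Type*} [TopologicalSpace G] [ChartedSpace H G] [Group G]
  {E' : Type*} [NormedAddCommGroup E'] [NormedSpace ℝ E']
  {H' : Type*} [TopologicalSpace H'] (J : ModelWithCorners ℝ E' H') [J.Boundaryless]
  {P : Type*} [TopologicalSpace P] [ChartedSpace H' P] [IsManifold J ∞ P] [MulAction G P]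

/-- The action read in the preferred charts at `1` and `x`. -/
noncomputable def actionInCharts (x : P) (p : E × E') : E' :=
  extChartAt J x ((extChartAt I (1 : G)).symm p.1 • (extChartAt J x).symm p.2)

variable [IsManifold I ∞ G] [ContMDiffSMul I J ∞ G P]

theorem contDiffAt_actionInCharts (x : P) :
    ContDiffAt ℝ 2 (actionInCharts I J (G := G) x)
      (extChartAt I (1 : G) 1, extChartAt J x x) := by
  have hφ : ContMDiffAt 𝓘(ℝ, E × E') I ∞
      (fun p : E × E' => (extChartAt I (1 : G)).symm p.1)
      (extChartAt I (1 : G) 1, extChartAt J x x) :=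
    ContMDiffAt.comp (g := (extChartAt I (1 : G)).symm) (f := Prod.fst) _
      ((contMDiffOn_extChartAt_symm (n := ∞) (1 : G)).contMDiffAt (extChartAt_target_mem_nhds 1))
      contDiff_fst.contMDiff.contMDiffAt
  have hψ : ContMDiffAt 𝓘(ℝ, E × E') J ∞
      (fun p : E × E' => (extChartAt J x).symm p.2)
      (extChartAt I (1 : G) 1, extChartAt J x x) :=
    ContMDiffAt.comp (g := (extChartAt J x).symm) (f := Prod.snd) _
      ((contMDiffOn_extChartAt_symm (n := ∞) x).contMDiffAt (extChartAt_target_mem_nhds x))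
      contDiff_snd.contMDiff.contMDiffAt
  have hs : ContMDiffAt 𝓘(ℝ, E × E') J ∞
      (fun p : E × E' => (extChartAt I (1 : G)).symm p.1 • (extChartAt J x).symm p.2)
      (extChartAt I (1 : G) 1, extChartAt J x x) :=
    ((ContMDiffSMul.contMDiff_smul (I := I) (I' := J) (n := ∞) (G := G) (M := P)).contMDiffAt).comp
      _ (hφ.prodMk hψ)
  have h : ContMDiffAt 𝓘(ℝ, E × E') 𝓘(ℝ, E') ∞ (actionInCharts I J (G := G) x)
      (extChartAt I (1 : G) 1, extChartAt J x x) := by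
    refine ContMDiffAt.comp_of_eq (g := extChartAt J x)
      (contMDiffAt_extChartAt (n := ∞) (x := x)) hs ?_
    simp
  exact h.contDiffAt.of_le (by norm_cast)

end Action

section Main

variable {E : Type*} [NormedAddCommGroup E] [NormedSpace ℝ E]
  {H : Type*} [TopologicalSpace H] (I : ModelWithCorners ℝ E H) [I.Boundaryless]
  {G : Type*} [TopologicalSpace G] [ChartedSpace H G] [Group G] [IsManifold I ∞ G]
  {E' : Type*} [NormedAddCommGroup E'] [NormedSpace ℝ E']
  {H' : Type*} [TopologicalSpace H'] (J : ModelWithCorners ℝ E' H') [J.Boundaryless]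
  {P : Type*} [TopologicalSpace P] [ChartedSpace H' P] [IsManifold J ∞ P] [MulAction G P]
  [ContMDiffSMul I J ∞ G P]

theorem lieDeriv_infinitesimalAction {μ : MultiVectorField I G 4} (hμ : μ.IsSmooth)
    (hμ₁ : μ 1 = 0) {ξ : MultiVectorField J P 4} (hξ : ξ.IsSmooth)
    (hact : IsMultiplicativeAction μ ξ) (X : GroupLieAlgebra I G) (x : P) :
    ξ.lieDeriv (infinitesimalAction J P X) x =
      MultiVector.map 4 (infinitesimalActionAt I J x) (μ.intrinsicDeriv (1 : G) X) := by
  have hx := extChartAt_to_inv (I := J) x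
  have h1 := extChartAt_to_inv (I := I) (1 : G)
  have hM₀ : μ.inChart 1 (extChartAt I (1 : G) 1) = 0 := by
    rw [μ.inChart_extChartAt (mem_extChartAt_source _), hμ₁, map_zero]
  have ha₀ : ∀ᶠ y in 𝓝 (extChartAt J x x),
      actionInCharts I J (G := G) x (extChartAt I (1 : G) 1, y) = y := by
    filter_upwards [extChartAt_target_mem_nhds (I := J) x] with y hy
    rw [actionInCharts, h1, one_smul, (extChartAt J x).right_inv hy]
  -- the derivative in the group direction, at the point of `P` over `y` near `x`
  have hleft : ∀ y ∈ (extChartAt J x).target,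
      ∀ u : TangentSpace I (1 : G),
      fderiv ℝ (fun s => actionInCharts I J (G := G) x (s, y)) (extChartAt I (1 : G) 1)
        (chartDeriv I 1 1 u) = chartDeriv J x ((extChartAt J x).symm y)
          (infinitesimalActionAt I J ((extChartAt J x).symm y) u) := fun y hy u =>
    fderiv_inCharts_chartDeriv (x₁ := (1 : G)) (x₂ := x)
      (mdifferentiable_smul_const I J ((extChartAt J x).symm y) _)
      (mem_extChartAt_source _) (one_smul G _) ((extChartAt J x).map_target hy) u
  have hV : ∀ᶠ y in 𝓝 (extChartAt J x x),
      vectorFieldInChart (infinitesimalAction J P X) x y =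
        fderiv ℝ (fun s => actionInCharts I J (G := G) x (s, y)) (extChartAt I (1 : G) 1)
          (chartDeriv I 1 1 X) := by
    filter_upwards [extChartAt_target_mem_nhds (I := J) x] with y hy
    exact (hleft y hy X).symm
  have hmul : ∀ᶠ t in 𝓝 (extChartAt I (1 : G) 1),
      ξ.inChart x (actionInCharts I J (G := G) x (t, extChartAt J x x)) =
        MultiVector.map 4 (fderiv ℝ (fun y => actionInCharts I J (G := G) x (t, y))
          (extChartAt J x x)) (ξ.inChart x (extChartAt J x x)) +
        MultiVector.map 4 (fderiv ℝ (fun s => actionInCharts I J (G := G) x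
          (s, extChartAt J x x)) t) (μ.inChart 1 t) := by
    have hsrc : ∀ᶠ t in 𝓝 (extChartAt I (1 : G) 1),
        (extChartAt I (1 : G)).symm t • x ∈ (extChartAt J x).source := by
      have hc : ContinuousAt (fun t => (extChartAt I (1 : G)).symm t • x)
          (extChartAt I (1 : G) 1) :=
        ContinuousAt.comp (g := fun h : G => h • x)
          (mdifferentiable_smul_const I J x _).continuousAt (continuousAt_extChartAt_symm _)
      refine hc.eventually_mem ?_
      rw [h1, one_smul]
      exact extChartAt_source_mem_nhds x
    filter_upwards [extChartAt_target_mem_nhds (I := I) (1 : G), hsrc] with t ht hs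
    set g := (extChartAt I (1 : G)).symm t with hg
    have hgs : g ∈ (extChartAt I (1 : G)).source := (extChartAt I (1 : G)).map_target ht
    have hB : (fderiv ℝ (fun s => actionInCharts I J (G := G) x (s, extChartAt J x x)) t).comp
        (chartDeriv I 1 g) = (chartDeriv J x (g • x)).comp
          (mfderiv I J (fun h : G => h • x) g) := by
      ext u
      have h := fderiv_inCharts_chartDeriv (x₁ := (1 : G)) (x₂ := x)
        (mdifferentiable_smul_const I J x _) hgs rfl hs u
      rw [hg, (extChartAt I (1 : G)).right_inv ht] at h
      simp only [actionInCharts, hx]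
      exact h
    have hA : (fderiv ℝ (fun y => actionInCharts I J (G := G) x (t, y)) (extChartAt J x x)).comp
        (chartDeriv J x x) = (chartDeriv J x (g • x)).comp
          (mfderiv J J (fun y : P => g • y) x) := by
      ext u
      exact fderiv_inCharts_chartDeriv (x₁ := x) (x₂ := x)
        (mdifferentiable_const_smul I J g x) (mem_extChartAt_source _) rfl hs u
    have hat : actionInCharts I J (G := G) x (t, extChartAt J x x) = extChartAt J x (g • x) := by
      simp only [actionInCharts, hx, ← hg]
    have hMt : μ.inChart 1 t = MultiVector.map 4 (chartDeriv I 1 g) (μ g) := rfl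
    rw [hat, ξ.inChart_extChartAt hs, ξ.inChart_extChartAt (mem_extChartAt_source _), hMt,
      hact g x, map_add, MultiVector.map_comp_apply, MultiVector.map_comp_apply,
      MultiVector.map_comp_apply, MultiVector.map_comp_apply, hA, hB]
  have key := localLieDeriv_eq_of_localAction (contDiffAt_actionInCharts I J x) ha₀
    (hξ.differentiableAt_inChart x) (hμ.differentiableAt_inChart 1) hM₀ hmul hV
  have hinvx : (chartDeriv J x x).IsInvertible :=
    isInvertible_mfderiv_extChartAt (mem_extChartAt_source x)
  have hinv1 : (chartDeriv I (1 : G) 1).IsInvertible :=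
    isInvertible_mfderiv_extChartAt (mem_extChartAt_source _)
  have hcomm : (chartDerivInv J x).comp (fderiv ℝ (fun s => actionInCharts I J (G := G) x
      (s, extChartAt J x x)) (extChartAt I (1 : G) 1)) =
      (infinitesimalActionAt I J x).comp (chartDerivInv I (1 : G)) := by
    obtain ⟨A, hA⟩ := hinvx
    obtain ⟨B, hB⟩ := hinv1
    rw [chartDerivInv, chartDerivInv, ← hA, ← hB, ContinuousLinearMap.inverse_equiv,
      ContinuousLinearMap.inverse_equiv]
    ext u
    have h := hleft _ (mem_extChartAt_target x) (B.symm u)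
    rw [hx, ← hA, ← hB] at h
    simpa using congrArg A.symm h
  rw [MultiVectorField.lieDeriv, key, MultiVector.map_comp_apply, hcomm]
  rfl

end Main

theorem mainTheorem7
    {E : Type*} [NormedAddCommGroup E] [NormedSpace ℝ E] [FiniteDimensional ℝ E]
    {H : Type*} [TopologicalSpace H] (I : ModelWithCorners ℝ E H) [I.Boundaryless]
    {G : Type*} [TopologicalSpace G] [ChartedSpace H G] [Group G] [LieGroup I ∞ G]
    {E' : Type*} [NormedAddCommGroup E'] [NormedSpace ℝ E'] [FiniteDimensional ℝ E']
    {H' : Type*} [TopologicalSpace H'] (J : ModelWithCorners ℝ E' H') [J.Boundaryless]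
    {P : Type*} [TopologicalSpace P] [ChartedSpace H' P] [IsManifold J ∞ P]
    [MulAction G P] [ContMDiffSMul I J ∞ G P]
    (μ : MultiVectorField I G 4) (hμ : IsMultiplicative μ)
    (ξ : MultiVectorField J P 4) (hξ : IsQuatrisson ξ)
    (hact : IsMultiplicativeAction μ ξ) :
    (∀ X : GroupLieAlgebra I G,
      ξ.lieDeriv (infinitesimalAction J P X) =
        fun x => MultiVector.map 4 (infinitesimalActionAt I J x) (μ.intrinsicDeriv (1 : G) X)) ∧
    (∀ (X : GroupLieAlgebra I G) (θ : Fin 4 → (x : P) → (TangentSpace J x →L[ℝ] ℝ)) (x : P),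
      ξ.lieDeriv (infinitesimalAction J P X) x (fun i => θ i x) =
        fourBracket μ (fun i => inducedFunction I (θ i) x) X) := by
  have h := fun X x => lieDeriv_infinitesimalAction I J hμ.smooth hμ.apply_one hξ.smooth hact X x
  refine ⟨fun X => funext (h X), fun X θ x => ?_⟩
  rw [h X x]
  rfl
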